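/- Let $0<d<n$ be integers, let $U\subset\mathbb R^n$ be open, and let $H^d$ denote $d$-dimensional Hausdorff measure (normalized so as to agree with Lebesgue measure on $\mathbb R^d$). Let $E\subset U$ be closed in $U$. An *Almgren competitor* for $E$ in $U$ is a set $F$, closed in $U$, of the form $F=\varphi_1(E)$, where $\varphi_t:U\to U$, $t\in[0,1]$, is a family of maps such that $\varphi_0(x)=x$ for all $x\in U$; the map $(t,x)\mapsto\varphi_t(x)$ is continuous from $[0,1]\times U$ to $U$; $\varphi_1$ is Lipschitz; and, with $W_t=\{x\in U:\varphi_t(x)\neq x\}$, the set $\bigcup_{t\in[0,1]}\bigl(W_t\cup\varphi_t(W_t)\bigr)$ is relatively compact in $U$. The set $E$ is *Almgren-minimal of dimension $d$ in $U$* if $H^d(E\cap B)<\infty$ for every compact ball $B\subset U$ and $H^d(E\setminus F)\le H^d(F\setminus E)$ for every Almgren competitor $F$ for $E$ in $U$. **Corollary 2.37.** Let $P_1,P_2\subset\mathbb R^4$ be $2$-dimensional linear subspaces that are orthogonal, i.e. $\langle v,w\rangle=0$ for all $v\in P_1$ and $w\in P_2$. Then $P_1\cup P_2$ is Almgren-minimal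 of dimension $2$ in $\mathbb R^4$. -/

import Mathlib

open scoped MeasureTheory

/-- `E` is a (relatively) closed subset of `U`. -/
def IsClosedIn {n : ℕ} (U E : Set (EuclideanSpace ℝ (Fin n))) : Prop :=
  ∃ C : Set (EuclideanSpace ℝ (Fin n)), IsClosed C ∧ E = U ∩ C

/-- For a family `φ t`, `t ∈ [0, 1]`, of maps of `U` into itself, the union over `t ∈ [0, 1]` of
`W t ∪ φ t (W t)`, where `W t = {x ∈ U | φ t x ≠ x}` is the set of points moved by `φ t`. -/
def movedSet {n : ℕ} (U : Set (EuclideanSpace ℝ (Fin n)))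
    (φ : ℝ → EuclideanSpace ℝ (Fin n) → EuclideanSpace ℝ (Fin n)) :
    Set (EuclideanSpace ℝ (Fin n)) :=
  ⋃ t ∈ Set.Icc (0 : ℝ) 1, {x ∈ U | φ t x ≠ x} ∪ φ t '' {x ∈ U | φ t x ≠ x}

/-- The families `φ t : U → U`, `t ∈ [0, 1]`, used to deform subsets of `U`. Only the values
`φ t x` with `t ∈ [0, 1]` and `x ∈ U` matter. -/
structure IsAlmgrenDeformation {n : ℕ} (U : Set (EuclideanSpace ℝ (Fin n)))
    (φ : ℝ → EuclideanSpace ℝ (Fin n) → EuclideanSpace ℝ (Fin n)) : Prop where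
  mapsTo : ∀ t ∈ Set.Icc (0 : ℝ) 1, Set.MapsTo (φ t) U U
  zero : ∀ x ∈ U, φ 0 x = x
  continuousOn : ContinuousOn (fun p : ℝ × EuclideanSpace ℝ (Fin n) => φ p.1 p.2)
    (Set.Icc (0 : ℝ) 1 ×ˢ U)
  lipschitz : ∃ K : NNReal, LipschitzOnWith K (φ 1) U
  /-- The set of moved points and their images is relatively compact in `U`. -/
  relCompact : ∃ K : Set (EuclideanSpace ℝ (Fin n)), IsCompact K ∧ K ⊆ U ∧ movedSet U φ ⊆ K

/-- `F` is an Almgren competitor for `E` in `U`: a closed set `F = φ 1 (E)` for some deformation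
`φ` in `U`. -/
def IsAlmgrenCompetitor {n : ℕ} (U E F : Set (EuclideanSpace ℝ (Fin n))) : Prop :=
  IsClosedIn U F ∧
    ∃ φ : ℝ → EuclideanSpace ℝ (Fin n) → EuclideanSpace ℝ (Fin n),
      IsAlmgrenDeformation U φ ∧ F = φ 1 '' E

/-- `E` is Almgren-minimal of dimension `d` in the open set `U` of `ℝⁿ`, where `0 < d < n`. Here
`μHE[d]` is the `d`-dimensional Hausdorff measure, normalized so that it is Lebesgue measure on
`ℝᵈ`. -/
structure IsAlmgrenMinimal {n : ℕ} (d : ℕ) (U E : Set (EuclideanSpace ℝ (Fin n))) : Prop where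
  dim_pos : 0 < d
  dim_lt : d < n
  isOpen : IsOpen U
  isClosedIn : IsClosedIn U E
  finite : ∀ (x : EuclideanSpace ℝ (Fin n)) (r : ℝ), Metric.closedBall x r ⊆ U →
    μHE[d] (E ∩ Metric.closedBall x r) < ⊤
  minimal : ∀ F : Set (EuclideanSpace ℝ (Fin n)), IsAlmgrenCompetitor U E F →
    μHE[d] (E \ F) ≤ μHE[d] (F \ E)

/-! The pair of orthogonal projections `q₁`, `q₂` onto the planes acts as a calibration. A deformed
plane still projects onto that plane, since a planar map equal to the identity near infinity is
onto. So a point of `P₁` missed by the competitor `F` is the projection of some point of `F`. That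
point is not in `P₁`, where `q₁` is injective, and points of `P₂` project only to the origin. Hence,
up to one point, `P₁ \ F` lies in the projection of `F \ (P₁ ∪ P₂)` (`measure_range_diff_le`);
likewise for `P₂`.

It remains to bound the sum of the two projected areas of `F \ (P₁ ∪ P₂)` by its area
(`projectedArea_le_euclideanHausdorffMeasure`). On a single plane the two Jacobians add up to at
most `1`, because `‖q₁ v‖² + ‖q₂ v‖² ≤ ‖v‖²`. As `F` is a union of two Lipschitz images of the
plane, linearization on small pieces transfers this to `F`. -/

open MeasureTheory Module Set
open scoped NNReal ENNReal

/-! ### Degree argument in the plane -/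

section Surjectivity

/-- A continuous self-map of the complex plane that is the identity near infinity is onto. -/
theorem Complex.surjective_of_eq_id_off_ball {g : ℂ → ℂ} (hg : Continuous g) {R : ℝ}
    (hR : ∀ z, R < ‖z‖ → g z = z) : Function.Surjective g := by
  intro y
  by_contra! hy
  -- If `y` is missed, `g - y` has a continuous logarithm on the plane, although it winds once
  -- around `0` along a large circle centred at `y`.
  obtain ⟨h, hh, hexp⟩ := Complex.exists_continuousOn_eqOn_exp_comp (U := univ)
    (Homeomorph.Set.univ ℂ).toHomotopyEquiv.simplyConnectedSpace isOpen_univ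
    (g := fun z => g z - y) (by fun_prop) (by
      rintro ⟨z, -, hz⟩
      exact hy z (sub_eq_zero.1 hz))
  rw [continuousOn_univ] at hh
  set r : ℝ := |R| + ‖y‖ + 1 with hr
  have hgr : ∀ θ : ℝ, g (y + r * exp (θ * I)) = y + r * exp (θ * I) := by
    intro θ
    apply hR
    have h1 : ‖(r : ℂ) * exp (θ * I)‖ = r := by
      rw [norm_mul, Complex.norm_exp_ofReal_mul_I, mul_one, Complex.norm_real, Real.norm_eq_abs,
        abs_of_pos (by positivity)]
    have h2 : ‖(r : ℂ) * exp (θ * I)‖ ≤ ‖y + r * exp (θ * I)‖ + ‖y‖ := by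
      simpa using norm_sub_le (y + r * exp (θ * I)) y
    have := le_abs_self R
    linarith
  have key : ∀ θ : ℝ, exp (h (y + r * exp (θ * I)) - θ * I) = r := by
    intro θ
    have := hexp (mem_univ (y + r * exp (θ * I)))
    simp only [Function.comp_apply, hgr, add_sub_cancel_left] at this
    rw [Complex.exp_sub, this, mul_div_cancel_right₀ _ (Complex.exp_ne_zero _)]
  have hconst := Complex.isCoveringMap_exp.const_of_comp
    (g := fun θ : ℝ => h (y + r * exp (θ * I)) - θ * I) (by fun_prop)
    (fun a b => Subtype.ext (by simp [key])) 0 (2 * Real.pi)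
  have : (2 * Real.pi * I : ℂ) = 0 := by
    simp only [Complex.ofReal_zero, zero_mul, Complex.exp_zero, Complex.ofReal_mul, Complex.ofReal_ofNat,
      Complex.exp_two_pi_mul_I] at hconst
    linear_combination hconst
  simp [Real.pi_ne_zero] at this

theorem EuclideanSpace.surjective_of_eq_id_off_ball
    {g : EuclideanSpace ℝ (Fin 2) → EuclideanSpace ℝ (Fin 2)} (hg : Continuous g) {R : ℝ}
    (hR : ∀ z, R < ‖z‖ → g z = z) : Function.Surjective g := by
  let e := Complex.orthonormalBasisOneI.repr
  have h := Complex.surjective_of_eq_id_off_ball (g := fun z => e.symm (g (e z)))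
    (by fun_prop) (R := R) (fun z hz => by rw [hR (e z) (by simpa using hz)]; simp)
  intro y
  obtain ⟨z, hz⟩ := h (e.symm y)
  exact ⟨e z, e.symm.injective hz⟩

end Surjectivity

/-! ### Linear algebra of the calibration -/

section Linear

variable {V : Type*} [NormedAddCommGroup V] [InnerProductSpace ℝ V] [FiniteDimensional ℝ V]

theorem Submodule.exists_linearIsometry_range_eq {d : ℕ} (S : Submodule ℝ V)
    (hS : finrank ℝ S = d) :
    ∃ U : EuclideanSpace ℝ (Fin d) →ₗᵢ[ℝ] V, ∀ v, v ∈ S ↔ ∃ x, U x = v := by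
  let b := (stdOrthonormalBasis ℝ S).reindex (finCongr hS)
  refine ⟨S.subtypeₗᵢ.comp b.repr.symm.toLinearIsometry, fun v => ⟨fun hv => ?_, ?_⟩⟩
  · exact ⟨b.repr ⟨v, hv⟩, by simp⟩
  · rintro ⟨x, rfl⟩
    exact (b.repr.symm x).2

theorem LinearIsometry.adjoint_apply_self {E : Type*} [NormedAddCommGroup E]
    [InnerProductSpace ℝ E] [CompleteSpace E] (U : E →ₗᵢ[ℝ] V) (x : E) :
    ContinuousLinearMap.adjoint U.toContinuousLinearMap (U x) = x :=
  congr($(LinearIsometry.adjoint_comp_self U) x)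

theorem LinearIsometry.norm_adjoint_apply_le {E : Type*} [NormedAddCommGroup E]
    [InnerProductSpace ℝ E] [CompleteSpace E] (U : E →ₗᵢ[ℝ] V) (v : V) :
    ‖ContinuousLinearMap.adjoint U.toContinuousLinearMap v‖ ≤ ‖v‖ := by
  refine (ContinuousLinearMap.le_of_opNorm_le (c := 1) _ ?_ v).trans (by simp)
  rw [LinearIsometryEquiv.norm_map]
  exact U.norm_toContinuousLinearMap_le

theorem EuclideanSpace.abs_det_le (M : EuclideanSpace ℝ (Fin 2) →L[ℝ] EuclideanSpace ℝ (Fin 2)) :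
    |M.det| ≤ (‖M (EuclideanSpace.single 0 1)‖ ^ 2 + ‖M (EuclideanSpace.single 1 1)‖ ^ 2) / 2 := by
  have h : M.det = M (EuclideanSpace.single 0 1) 0 * M (EuclideanSpace.single 1 1) 1
      - M (EuclideanSpace.single 1 1) 0 * M (EuclideanSpace.single 0 1) 1 := by
    rw [ContinuousLinearMap.det,
      ← LinearMap.det_toMatrix (EuclideanSpace.basisFun (Fin 2) ℝ).toBasis, Matrix.det_fin_two]
    simp [LinearMap.toMatrix_apply]
  rw [h, EuclideanSpace.real_norm_sq_eq, EuclideanSpace.real_norm_sq_eq, Fin.sum_univ_two,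
    Fin.sum_univ_two]
  generalize M (EuclideanSpace.single 0 1) 0 = a
  generalize M (EuclideanSpace.single 1 1) 1 = b
  generalize M (EuclideanSpace.single 1 1) 0 = c
  generalize M (EuclideanSpace.single 0 1) 1 = d
  rw [abs_le]
  constructor <;> nlinarith [sq_nonneg (a + b), sq_nonneg (a - b), sq_nonneg (c + d),
    sq_nonneg (c - d)]

/-- The two forms `(x, y) ↦ det (q₁ x, q₁ y)` and `(x, y) ↦ det (q₂ x, q₂ y)` have, together,
comass at most one. -/
theorem EuclideanSpace.abs_det_add_abs_det_le_one
    {M₁ M₂ : EuclideanSpace ℝ (Fin 2) →L[ℝ] EuclideanSpace ℝ (Fin 2)}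
    (h : ∀ x, ‖M₁ x‖ ^ 2 + ‖M₂ x‖ ^ 2 ≤ ‖x‖ ^ 2) : |M₁.det| + |M₂.det| ≤ 1 := by
  have h₁ := EuclideanSpace.abs_det_le M₁
  have h₂ := EuclideanSpace.abs_det_le M₂
  have h₃ := h (EuclideanSpace.single 0 1)
  have h₄ := h (EuclideanSpace.single 1 1)
  simp only [PiLp.norm_single, norm_one, one_pow] at h₃ h₄
  linarith

end Linear

/-! ### Measure-theoretic tools -/

section Measure

theorem LipschitzWith.euclideanHausdorffMeasure_image_le {X Y : Type*} [EMetricSpace X]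
    [EMetricSpace Y] [MeasurableSpace X] [BorelSpace X] [MeasurableSpace Y] [BorelSpace Y]
    {K : ℝ≥0} {f : X → Y} (hf : LipschitzWith K f) (d : ℕ) (s : Set X) :
    μHE[d] (f '' s) ≤ K ^ d * μHE[d] s := by
  have := hf.hausdorffMeasure_image_le (d := d) (by positivity) s
  rw [ENNReal.rpow_natCast] at this
  simp only [Measure.euclideanHausdorffMeasure_def, Measure.smul_apply, ENNReal.smul_def,
    smul_eq_mul]
  rw [mul_left_comm]
  gcongr

/-- An outer inequality `m t ≤ c * μ t`, with `m` countably subadditive, holds for all subsets of a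
countable union of measurable sets once it holds for all subsets of each of them. -/
theorem MeasureTheory.le_mul_measure_of_subset_iUnion {X ι : Type*} [MeasurableSpace X]
    [Countable ι] (m : OuterMeasure X) (μ : Measure X) (c : ℝ≥0∞) (S : ι → Set X)
    (hS : ∀ i, MeasurableSet (S i)) (h : ∀ i, ∀ t ⊆ S i, m t ≤ c * μ t) :
    ∀ t ⊆ ⋃ i, S i, m t ≤ c * μ t := by
  intro t ht
  rcases isEmpty_or_nonempty ι with hι | hι
  · rw [iUnion_of_empty, subset_empty_iff] at ht
    simp [ht]
  obtain ⟨e, he⟩ := exists_surjective_nat ι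
  -- Disjoint measurable pieces make `μ` add up exactly, even though `t` itself need not be
  -- measurable.
  have hD : ∀ n, MeasurableSet (disjointed (S ∘ e) n) :=
    fun n => MeasurableSet.disjointed (fun i => hS (e i)) n
  have hU : t = ⋃ n, t ∩ disjointed (S ∘ e) n := by
    rw [← inter_iUnion, iUnion_disjointed, eq_comm, inter_eq_left]
    simpa [he.iUnion_comp S] using ht
  have hsum : ∑' n, μ (t ∩ disjointed (S ∘ e) n) ≤ μ t := by
    have := measure_iUnion (μ := μ.restrict t) (disjoint_disjointed (S ∘ e)) hD
    calc ∑' n, μ (t ∩ disjointed (S ∘ e) n)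
        = ∑' n, μ.restrict t (disjointed (S ∘ e) n) := by
          simp_rw [Measure.restrict_apply (hD _), inter_comm]
      _ = μ.restrict t (⋃ n, disjointed (S ∘ e) n) := this.symm
      _ ≤ μ.restrict t univ := measure_mono (subset_univ _)
      _ = μ t := Measure.restrict_apply_univ t
  calc m t = m (⋃ n, t ∩ disjointed (S ∘ e) n) := by rw [← hU]
    _ ≤ ∑' n, m (t ∩ disjointed (S ∘ e) n) := measure_iUnion_le _
    _ ≤ ∑' n, c * μ (t ∩ disjointed (S ∘ e) n) := by
        refine ENNReal.tsum_le_tsum fun n => h (e n) _ ?_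
        exact inter_subset_right.trans (disjointed_subset (S ∘ e) n)
    _ = c * ∑' n, μ (t ∩ disjointed (S ∘ e) n) := ENNReal.tsum_mul_left
    _ ≤ c * μ t := by gcongr

theorem ApproximatesLinearOn.closure {E F : Type*} [NormedAddCommGroup E] [NormedSpace ℝ E]
    [NormedAddCommGroup F] [NormedSpace ℝ F] {f : E → F} {A : E →L[ℝ] F} {s : Set E} {c : ℝ≥0}
    (h : ApproximatesLinearOn f A s c) (hf : Continuous f) :
    ApproximatesLinearOn f A (closure s) c := by
  have hc : IsClosed {p : E × E | ‖f p.1 - f p.2 - A (p.1 - p.2)‖ ≤ c * ‖p.1 - p.2‖} :=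
    isClosed_le (by fun_prop) (by fun_prop)
  have := closure_minimal (s := s ×ˢ s) (fun p hp => h p.1 hp.1 p.2 hp.2) hc
  rw [closure_prod_eq] at this
  exact fun x hx y hy => this (mk_mem_prod hx hy)

end Measure

/-! ### The calibration inequality -/

section Calibration

variable {V : Type*} [NormedAddCommGroup V] [InnerProductSpace ℝ V] [FiniteDimensional ℝ V]
  [MeasurableSpace V] [BorelSpace V] {q₁ q₂ : V →L[ℝ] EuclideanSpace ℝ (Fin 2)}

/-- The sum of the areas of the two projections of a set. -/
noncomputable def projectedArea (q₁ q₂ : V →L[ℝ] EuclideanSpace ℝ (Fin 2)) : OuterMeasure V :=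
  OuterMeasure.comap q₁ volume.toOuterMeasure + OuterMeasure.comap q₂ volume.toOuterMeasure

omit [FiniteDimensional ℝ V] [MeasurableSpace V] [BorelSpace V] in
theorem projectedArea_apply (q₁ q₂ : V →L[ℝ] EuclideanSpace ℝ (Fin 2)) (s : Set V) :
    projectedArea q₁ q₂ s = volume (q₁ '' s) + volume (q₂ '' s) := rfl

/-- Near a point where the derivative of `f` is injective, the areas of the two projections add up
to at most the area, up to a factor close to `1`. -/
theorem exists_projectedArea_image_le (hq : ∀ v, ‖q₁ v‖ ^ 2 + ‖q₂ v‖ ^ 2 ≤ ‖v‖ ^ 2)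
    (A : EuclideanSpace ℝ (Fin 2) →L[ℝ] V) (hA : Function.Injective A) {η : ℝ≥0} (hη : 0 < η) :
    ∃ δ : ℝ≥0, 0 < δ ∧ ∀ (f : EuclideanSpace ℝ (Fin 2) → V) (s : Set (EuclideanSpace ℝ (Fin 2))),
      ApproximatesLinearOn f A s δ →
        projectedArea q₁ q₂ (f '' s) ≤ (1 + η : ℝ≥0) * μHE[2] (f '' s) := by
  obtain ⟨U, hU⟩ := Submodule.exists_linearIsometry_range_eq (d := 2) A.range
    (by rw [LinearMap.finrank_range_of_inj hA]; simp)
  set p := ContinuousLinearMap.adjoint U.toContinuousLinearMap with hp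
  have hpU : ∀ x, p (U x) = x := U.adjoint_apply_self
  have hp1 : ∀ v, ‖p v‖ ≤ ‖v‖ := U.norm_adjoint_apply_le
  have hUp : ∀ x, U (p (A x)) = A x := by
    intro x
    obtain ⟨y, hy⟩ := (hU (A x)).1 ⟨x, rfl⟩
    rw [← hy, hpU]
  -- `p` gives coordinates on the tangent plane, the range of `A`; every determinant is compared
  -- with that of `p ∘L A`.
  have hdet : ∀ q : V →L[ℝ] EuclideanSpace ℝ (Fin 2),
      |(q ∘L A).det| = |(q ∘L U.toContinuousLinearMap).det| * |(p ∘L A).det| := by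
    intro q
    rw [← abs_mul]
    have : q ∘L A = (q ∘L U.toContinuousLinearMap) ∘L (p ∘L A) := by
      ext1 x
      simp [hUp]
    conv_lhs => rw [this]
    congr 1
    exact LinearMap.det_comp _ _
  have hb : 0 < |(p ∘L A).det| := by
    rw [abs_pos]
    intro h0
    obtain ⟨x, hx, hx0⟩ := (Submodule.ne_bot_iff _).1
      (LinearMap.bot_lt_ker_of_det_eq_zero (show LinearMap.det (p ∘L A).toLinearMap = 0 from h0)).ne'
    refine hx0 (hA ?_)
    rw [← hUp x, show p (A x) = 0 from hx, map_zero, map_zero]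
  have hcal : |(q₁ ∘L A).det| + |(q₂ ∘L A).det| ≤ |(p ∘L A).det| := by
    rw [hdet q₁, hdet q₂, ← add_mul]
    refine mul_le_of_le_one_left (abs_nonneg _)
      (EuclideanSpace.abs_det_add_abs_det_le_one fun x => ?_)
    simpa using hq (U x)
  lift |(p ∘L A).det| to ℝ≥0 using abs_nonneg _ with b hbe
  lift |(q₁ ∘L A).det| to ℝ≥0 using abs_nonneg _ with a₁ ha₁
  lift |(q₂ ∘L A).det| to ℝ≥0 using abs_nonneg _ with a₂ ha₂
  norm_cast at hb hcal
  -- The bounds below are balanced: `1 + η` times the lower one is `b + η b / 2`, which dominates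
  -- the sum of the two upper ones as `a₁ + a₂ ≤ b`.
  have hηb : 0 < η * b := mul_pos hη hb
  obtain ⟨δ, ⟨⟨h₁, h₂⟩, h₃⟩, hδ⟩ := (((addHaar_image_le_mul_of_det_lt volume (q₁ ∘L A)
    (m := a₁ + η * b / 4) (by
      rw [← ha₁, ENNReal.ofReal_coe_nnreal]
      exact_mod_cast lt_add_of_pos_right _ (by positivity))).and
    (addHaar_image_le_mul_of_det_lt volume (q₂ ∘L A) (m := a₂ + η * b / 4) (by
      rw [← ha₂, ENNReal.ofReal_coe_nnreal]
      exact_mod_cast lt_add_of_pos_right _ (by positivity)))).and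
    (mul_le_addHaar_image_of_lt_det volume (p ∘L A) (m := b * ((1 + η / 2) / (1 + η))) (by
      rw [← hbe, ENNReal.ofReal_coe_nnreal]
      norm_cast
      refine mul_lt_of_lt_one_right hb ((div_lt_one (by positivity)).2 ?_)
      gcongr
      exact NNReal.half_lt_self hη.ne'))).and self_mem_nhdsWithin |>.exists
  refine ⟨δ, hδ, fun f s hf => ?_⟩
  have happ : ∀ q : V →L[ℝ] EuclideanSpace ℝ (Fin 2), (∀ v, ‖q v‖ ≤ ‖v‖) →
      ApproximatesLinearOn (q ∘ f) (q ∘L A) s δ := by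
    intro q hq x hx y hy
    simpa using (hq _).trans (hf x hx y hy)
  have hq₁ : ∀ v, ‖q₁ v‖ ≤ ‖v‖ := fun v =>
    le_of_sq_le_sq (by linarith [hq v, sq_nonneg ‖q₂ v‖]) (norm_nonneg _)
  have hq₂ : ∀ v, ‖q₂ v‖ ≤ ‖v‖ := fun v =>
    le_of_sq_le_sq (by linarith [hq v, sq_nonneg ‖q₁ v‖]) (norm_nonneg _)
  have hLp : LipschitzWith 1 p := p.lipschitz.weaken (by
    exact p.opNorm_le_bound zero_le_one (by simpa using hp1))
  calc projectedArea q₁ q₂ (f '' s)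
      = volume ((q₁ ∘ f) '' s) + volume ((q₂ ∘ f) '' s) := by
        rw [projectedArea_apply, image_comp, image_comp]
    _ ≤ (a₁ + η * b / 4 : ℝ≥0) * volume s + (a₂ + η * b / 4 : ℝ≥0) * volume s :=
        add_le_add (h₁ s _ (happ q₁ hq₁)) (h₂ s _ (happ q₂ hq₂))
    _ = ((a₁ + η * b / 4) + (a₂ + η * b / 4) : ℝ≥0) * volume s := by
        rw [ENNReal.coe_add (a₁ + _), add_mul]
    _ ≤ ((1 + η) * (b * ((1 + η / 2) / (1 + η))) : ℝ≥0) * volume s := by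
        gcongr
        have : (1 + η) * (b * ((1 + η / 2) / (1 + η))) = b + η * b / 2 := by
          field_simp
        rw [this]
        rw [← NNReal.coe_le_coe] at hcal ⊢
        push_cast at hcal ⊢
        linarith
    _ = (1 + η : ℝ≥0) * ((b * ((1 + η / 2) / (1 + η)) : ℝ≥0) * volume s) := by
        rw [ENNReal.coe_mul, mul_assoc]
    _ ≤ (1 + η : ℝ≥0) * volume ((p ∘ f) '' s) := by
        gcongr
        exact h₃ s _ (happ p hp1)
    _ ≤ (1 + η : ℝ≥0) * μHE[2] (f '' s) := by
        gcongr
        -- `p` is 1-Lipschitz, so no area formula is needed.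
        rw [image_comp, ← EuclideanSpace.euclideanHausdorffMeasure_eq_volume]
        simpa using hLp.euclideanHausdorffMeasure_image_le 2 (f '' s)

/-- A Lipschitz image of the plane is covered by countably many measurable sets on which the
areas of the projections are controlled, up to a set with null projections. -/
theorem LipschitzWith.exists_cover_projectedArea_le
    (hq : ∀ v, ‖q₁ v‖ ^ 2 + ‖q₂ v‖ ^ 2 ≤ ‖v‖ ^ 2) {K : ℝ≥0}
    {f : EuclideanSpace ℝ (Fin 2) → V} (hf : LipschitzWith K f) {η : ℝ≥0} (hη : 0 < η) :
    ∃ (S : ℕ → Set V) (N : Set V), (∀ n, MeasurableSet (S n)) ∧ projectedArea q₁ q₂ N = 0 ∧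
      range f ⊆ (⋃ n, S n) ∪ N ∧
      ∀ n, ∀ t ⊆ S n, projectedArea q₁ q₂ t ≤ (1 + η : ℝ≥0) * μHE[2] t := by
  choose! r hr0 hr using fun A hA => exists_projectedArea_image_le hq A hA hη
  let s := {x | DifferentiableAt ℝ f x ∧ Function.Injective (fderiv ℝ f x)}
  let Z := {x | DifferentiableAt ℝ f x ∧ ¬ Function.Injective (fderiv ℝ f x)}
  let N := {x | ¬ DifferentiableAt ℝ f x}
  classical
  obtain ⟨t, A, -, hst, happ, hA⟩ :=
    exists_closed_cover_approximatesLinearOn_of_hasFDerivWithinAt f s (fderiv ℝ f)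
      (fun x hx => hx.1.hasFDerivAt.hasFDerivWithinAt)
      (fun A => if Function.Injective A then r A else 1) (fun A => by
        split_ifs with h
        · exact (hr0 A h).ne'
        · exact one_ne_zero)
  -- Closures make the images σ-compact, hence measurable; the linear approximation survives by
  -- continuity.
  refine ⟨fun n => f '' closure (s ∩ t n), f '' (Z ∪ N), fun n => ?_, ?_, ?_, ?_⟩
  · obtain ⟨k, hk, hkU⟩ := (isSigmaCompact_univ.of_isClosed_subset
      (isClosed_closure (s := s ∩ t n)) (subset_univ _)).image hf.continuous
    change MeasurableSet (f '' closure (s ∩ t n))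
    rw [← hkU]
    exact MeasurableSet.iUnion fun i => (hk i).measurableSet
  · have hnull : ∀ q : V →L[ℝ] EuclideanSpace ℝ (Fin 2), volume (q '' (f '' (Z ∪ N))) = 0 := by
      intro q
      rw [← image_comp, image_union, measure_union_null_iff]
      constructor
      · refine addHaar_image_eq_zero_of_det_fderivWithin_eq_zero volume
          (f' := fun x => q ∘L fderiv ℝ f x)
          (fun x hx => (q.hasFDerivAt.comp x hx.1.hasFDerivAt).hasFDerivWithinAt) fun x hx => ?_
        by_contra hdet
        refine hx.2 (Function.Injective.of_comp (f := q) ?_)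
        exact (LinearMap.equivOfDetNeZero (q ∘L fderiv ℝ f x).toLinearMap hdet).injective
      · have h0 : volume N = 0 := hf.ae_differentiableAt
        have := (q.lipschitz.comp hf).euclideanHausdorffMeasure_image_le 2 N
        rw [EuclideanSpace.euclideanHausdorffMeasure_eq_volume, h0, mul_zero] at this
        exact le_antisymm this zero_le
    rw [projectedArea_apply, hnull, hnull, add_zero]
  · rintro _ ⟨x, rfl⟩
    by_cases hx : x ∈ s
    · obtain ⟨n, hn⟩ := mem_iUnion.1 (hst hx)
      exact Or.inl (mem_iUnion.2 ⟨n, x, subset_closure ⟨hx, hn⟩, rfl⟩)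
    · refine Or.inr ⟨x, ?_, rfl⟩
      by_cases hd : DifferentiableAt ℝ f x
      · exact Or.inl ⟨hd, fun h => hx ⟨hd, h⟩⟩
      · exact Or.inr hd
  · intro n u hu
    obtain ⟨w, hw, rfl⟩ := subset_image_iff.1 hu
    rcases s.eq_empty_or_nonempty with hs | hs
    · simp only [hs, empty_inter, closure_empty, subset_empty_iff] at hw
      simp [hw]
    obtain ⟨y, hy, hAy⟩ := hA hs n
    have hinj : Function.Injective (A n) := hAy ▸ hy.2
    have := happ n
    rw [if_pos hinj] at this
    exact hr (A n) hinj f w ((this.closure hf.continuous).mono_set hw)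

/-- **Calibration inequality**: for subsets of a countable union of Lipschitz images of the plane,
the areas of the two projections add up to at most the area. -/
theorem projectedArea_le_euclideanHausdorffMeasure {ι : Type*} [Countable ι]
    (hq : ∀ v, ‖q₁ v‖ ^ 2 + ‖q₂ v‖ ^ 2 ≤ ‖v‖ ^ 2)
    (f : ι → EuclideanSpace ℝ (Fin 2) → V) (hf : ∀ i, ∃ K, LipschitzWith K (f i)) {t : Set V}
    (ht : t ⊆ ⋃ i, range (f i)) : projectedArea q₁ q₂ t ≤ μHE[2] t := by
  choose K hK using hf
  have key : ∀ η : ℝ≥0, 0 < η → projectedArea q₁ q₂ t ≤ (1 + η : ℝ≥0) * μHE[2] t := by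
    intro η hη
    choose S N hS hN hcov hle using fun i => (hK i).exists_cover_projectedArea_le hq hη
    have h := le_mul_measure_of_subset_iUnion (projectedArea q₁ q₂) μHE[2] (1 + η : ℝ≥0)
      (fun k : ι × ℕ => S k.1 k.2) (fun k => hS k.1 k.2) (fun k => hle k.1 k.2)
      (t ∩ ⋃ k : ι × ℕ, S k.1 k.2) inter_subset_right
    have hsub : t ⊆ (t ∩ ⋃ k : ι × ℕ, S k.1 k.2) ∪ ⋃ i, N i := by
      intro x hx
      obtain ⟨i, hi⟩ := mem_iUnion.1 (ht hx)
      rcases hcov i hi with h' | h'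
      · obtain ⟨n, hn⟩ := mem_iUnion.1 h'
        exact Or.inl ⟨hx, mem_iUnion.2 ⟨(i, n), hn⟩⟩
      · exact Or.inr (mem_iUnion.2 ⟨i, h'⟩)
    calc projectedArea q₁ q₂ t ≤ projectedArea q₁ q₂ ((t ∩ ⋃ k : ι × ℕ, S k.1 k.2) ∪ ⋃ i, N i) :=
          measure_mono hsub
      _ ≤ projectedArea q₁ q₂ (t ∩ ⋃ k : ι × ℕ, S k.1 k.2) + projectedArea q₁ q₂ (⋃ i, N i) :=
          measure_union_le _ _
      _ = projectedArea q₁ q₂ (t ∩ ⋃ k : ι × ℕ, S k.1 k.2) := by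
          rw [measure_iUnion_null hN, add_zero]
      _ ≤ _ := h
      _ ≤ _ := by gcongr; exact inter_subset_left
  rcases eq_or_ne (μHE[2] t) ⊤ with htop | htop
  · simp [htop]
  have hlim : Filter.Tendsto (fun η : ℝ≥0 => ((1 + η : ℝ≥0) : ℝ≥0∞) * μHE[2] t)
      (nhdsWithin 0 (Ioi 0)) (nhds (((1 + 0 : ℝ≥0) : ℝ≥0∞) * μHE[2] t)) := by
    refine ENNReal.Tendsto.mul_const ?_ (Or.inr htop)
    refine ENNReal.tendsto_coe.2 ?_
    exact ((continuous_const.add continuous_id).tendsto 0).mono_left nhdsWithin_le_nhds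
  have := ge_of_tendsto hlim (Filter.eventually_of_mem self_mem_nhdsWithin key)
  simpa using this

end Calibration

/-! ### Deformations of the whole space -/

section Deformation

variable {n : ℕ} {φ : ℝ → EuclideanSpace ℝ (Fin n) → EuclideanSpace ℝ (Fin n)}

theorem IsAlmgrenDeformation.exists_lipschitzWith (hφ : IsAlmgrenDeformation univ φ) :
    ∃ K, LipschitzWith K (φ 1) := by
  obtain ⟨K, hK⟩ := hφ.lipschitz
  exact ⟨K, lipschitzOnWith_univ.1 hK⟩

theorem IsAlmgrenDeformation.exists_eq_self_of_lt_norm (hφ : IsAlmgrenDeformation univ φ) :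
    ∃ R : ℝ, ∀ x, R < ‖x‖ → φ 1 x = x := by
  obtain ⟨K, hK, -, hsub⟩ := hφ.relCompact
  obtain ⟨R, hR⟩ := hK.isBounded.exists_norm_le
  refine ⟨R, fun x hx => ?_⟩
  by_contra hne
  refine hx.not_ge (hR x (hsub ?_))
  exact mem_biUnion (x := (1 : ℝ)) (by simp) (Or.inl ⟨mem_univ x, hne⟩)

/-- The projection to a plane of the deformation of this plane covers the plane. -/
theorem IsAlmgrenDeformation.surjective_adjoint_comp (hφ : IsAlmgrenDeformation univ φ)
    (U : EuclideanSpace ℝ (Fin 2) →ₗᵢ[ℝ] EuclideanSpace ℝ (Fin n)) :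
    Function.Surjective fun x =>
      ContinuousLinearMap.adjoint U.toContinuousLinearMap (φ 1 (U x)) := by
  obtain ⟨K, hK⟩ := hφ.exists_lipschitzWith
  obtain ⟨R, hR⟩ := hφ.exists_eq_self_of_lt_norm
  refine EuclideanSpace.surjective_of_eq_id_off_ball (R := R)
    ((ContinuousLinearMap.continuous _).comp (hK.continuous.comp U.continuous)) fun z hz => ?_
  rw [hR _ (by simpa using hz), U.adjoint_apply_self]

end Deformation

/-! ### Orthogonal planes and minimality -/

section OrthogonalPlanes

variable {V : Type*} [NormedAddCommGroup V] [InnerProductSpace ℝ V] [FiniteDimensional ℝ V]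
  {E : Type*} [NormedAddCommGroup E] [InnerProductSpace ℝ E] [CompleteSpace E]

theorem LinearIsometry.adjoint_apply_eq_zero_of_inner_eq_zero {U₁ U₂ : E →ₗᵢ[ℝ] V}
    (hU : ∀ x y, inner ℝ (U₁ x) (U₂ y) = 0) (y : E) :
    ContinuousLinearMap.adjoint U₁.toContinuousLinearMap (U₂ y) = 0 := by
  refine ext_inner_left ℝ fun x => ?_
  rw [ContinuousLinearMap.adjoint_inner_right, inner_zero_right]
  exact hU x y

theorem LinearIsometry.norm_sq_adjoint_add_le {U₁ U₂ : E →ₗᵢ[ℝ] V}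
    (hU : ∀ x y, inner ℝ (U₁ x) (U₂ y) = 0) (v : V) :
    ‖ContinuousLinearMap.adjoint U₁.toContinuousLinearMap v‖ ^ 2 +
      ‖ContinuousLinearMap.adjoint U₂.toContinuousLinearMap v‖ ^ 2 ≤ ‖v‖ ^ 2 := by
  set x := ContinuousLinearMap.adjoint U₁.toContinuousLinearMap v with hx
  set y := ContinuousLinearMap.adjoint U₂.toContinuousLinearMap v with hy
  have h₁ : inner ℝ v (U₁ x) = ‖x‖ ^ 2 := by
    rw [← real_inner_self_eq_norm_sq, hx, ContinuousLinearMap.adjoint_inner_left]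
    rfl
  have h₂ : inner ℝ v (U₂ y) = ‖y‖ ^ 2 := by
    rw [← real_inner_self_eq_norm_sq, hy, ContinuousLinearMap.adjoint_inner_left]
    rfl
  have h₃ : ‖U₁ x + U₂ y‖ ^ 2 = ‖x‖ ^ 2 + ‖y‖ ^ 2 := by
    rw [norm_add_sq_real, hU, U₁.norm_map, U₂.norm_map]
    ring
  have h₄ : ‖v - (U₁ x + U₂ y)‖ ^ 2 = ‖v‖ ^ 2 - (‖x‖ ^ 2 + ‖y‖ ^ 2) := by
    rw [norm_sub_sq_real, inner_add_right, h₁, h₂, h₃]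
    ring
  linarith [sq_nonneg ‖v - (U₁ x + U₂ y)‖]

variable {n : ℕ} {U₁ U₂ : EuclideanSpace ℝ (Fin 2) →ₗᵢ[ℝ] EuclideanSpace ℝ (Fin n)}

/-- The part of the first plane that a deformation `F` of the union of two orthogonal planes
misses is no larger than the projection of the new part of `F`. -/
theorem IsAlmgrenDeformation.measure_range_diff_le
    {φ : ℝ → EuclideanSpace ℝ (Fin n) → EuclideanSpace ℝ (Fin n)}
    (hφ : IsAlmgrenDeformation univ φ) (hU : ∀ x y, inner ℝ (U₁ x) (U₂ y) = 0)
    {F : Set (EuclideanSpace ℝ (Fin n))} (hF : ∀ x, φ 1 (U₁ x) ∈ F) :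
    μHE[2] (range U₁ \ F) ≤ volume (ContinuousLinearMap.adjoint U₁.toContinuousLinearMap ''
      (F \ (range U₁ ∪ range U₂))) := by
  set q := ContinuousLinearMap.adjoint U₁.toContinuousLinearMap
  have hsub : U₁ ⁻¹' Fᶜ ⊆ q '' (F \ (range U₁ ∪ range U₂)) ∪ {0} := by
    intro x hx
    obtain ⟨y, hy⟩ := hφ.surjective_adjoint_comp U₁ x
    change q (φ 1 (U₁ y)) = x at hy
    by_cases h : φ 1 (U₁ y) ∈ range U₁ ∪ range U₂
    · rcases h with ⟨z, hz⟩ | ⟨z, hz⟩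
      · refine absurd (hF y) ?_
        have hzx : z = x := by rw [← hy, ← hz]; exact (U₁.adjoint_apply_self z).symm
        rw [← hz, hzx]
        exact hx
      · right
        rw [← hy, ← hz]
        exact LinearIsometry.adjoint_apply_eq_zero_of_inner_eq_zero hU z
    · exact Or.inl ⟨_, ⟨hF y, h⟩, hy⟩
  calc μHE[2] (range U₁ \ F) = volume (U₁ ⁻¹' Fᶜ) := by
        rw [← EuclideanSpace.euclideanHausdorffMeasure_eq_volume,
          U₁.isometry.euclideanHausdorffMeasure_preimage, inter_comm, Set.sdiff_eq]
    _ ≤ volume (q '' (F \ (range U₁ ∪ range U₂)) ∪ {0}) := measure_mono hsub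
    _ ≤ volume (q '' (F \ (range U₁ ∪ range U₂))) + volume {0} := measure_union_le _ _
    _ = _ := by rw [measure_singleton, add_zero]

theorem isAlmgrenMinimal_range_union_range (hn : 2 < n)
    (hU : ∀ x y, inner ℝ (U₁ x) (U₂ y) = 0) :
    IsAlmgrenMinimal 2 univ (range U₁ ∪ range U₂) where
  dim_pos := two_pos
  dim_lt := hn
  isOpen := isOpen_univ
  isClosedIn := ⟨_, U₁.isometry.isClosedEmbedding.isClosed_range.union
    U₂.isometry.isClosedEmbedding.isClosed_range, (univ_inter _).symm⟩
  finite x r _ := by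
    have h : ∀ U : EuclideanSpace ℝ (Fin 2) →ₗᵢ[ℝ] EuclideanSpace ℝ (Fin n),
        μHE[2] (range U ∩ Metric.closedBall x r) < ⊤ := by
      intro U
      rw [inter_comm, ← U.isometry.euclideanHausdorffMeasure_preimage,
        EuclideanSpace.euclideanHausdorffMeasure_eq_volume]
      exact (U.isometry.isClosedEmbedding.isCompact_preimage
        (isCompact_closedBall x r)).measure_lt_top
    rw [union_inter_distrib_right]
    exact measure_union_lt_top (h U₁) (h U₂)
  minimal := by
    rintro F ⟨-, φ, hφ, rfl⟩
    set P := range U₁ ∪ range U₂ with hP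
    obtain ⟨K, hK⟩ := hφ.exists_lipschitzWith
    have h₁ := hφ.measure_range_diff_le hU (F := φ 1 '' P) fun x => ⟨_, Or.inl ⟨x, rfl⟩, rfl⟩
    have h₂ := hφ.measure_range_diff_le (U₁ := U₂) (U₂ := U₁)
      (fun x y => by rw [real_inner_comm]; exact hU y x) (F := φ 1 '' P)
      fun x => ⟨_, Or.inr ⟨x, rfl⟩, rfl⟩
    rw [union_comm (range U₂)] at h₂
    have hcal := projectedArea_le_euclideanHausdorffMeasure
      (LinearIsometry.norm_sq_adjoint_add_le hU)
      (fun b : Bool => φ 1 ∘ ⇑(show EuclideanSpace ℝ (Fin 2) →ₗᵢ[ℝ] _ from cond b U₁ U₂))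
      (fun b => ⟨_, hK.comp (cond b U₁ U₂).lipschitz⟩)
      (t := φ 1 '' P \ P) (by
        rintro _ ⟨⟨_, ⟨x, rfl⟩ | ⟨x, rfl⟩, rfl⟩, -⟩
        · exact mem_iUnion.2 ⟨true, x, rfl⟩
        · exact mem_iUnion.2 ⟨false, x, rfl⟩)
    calc μHE[2] (P \ φ 1 '' P)
        ≤ μHE[2] (range U₁ \ φ 1 '' P) + μHE[2] (range U₂ \ φ 1 '' P) := by
          rw [hP, union_sdiff_distrib]
          exact measure_union_le _ _
      _ ≤ _ := add_le_add h₁ h₂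
      _ ≤ μHE[2] (φ 1 '' P \ P) := hcal

end OrthogonalPlanes

theorem corollary2p37 (P₁ P₂ : Submodule ℝ (EuclideanSpace ℝ (Fin 4)))
    (h₁ : Module.finrank ℝ P₁ = 2) (h₂ : Module.finrank ℝ P₂ = 2) (hP : P₁ ⟂ P₂) :
    IsAlmgrenMinimal 2 Set.univ
      ((P₁ : Set (EuclideanSpace ℝ (Fin 4))) ∪ (P₂ : Set (EuclideanSpace ℝ (Fin 4)))) := by
  obtain ⟨U₁, hU₁⟩ := P₁.exists_linearIsometry_range_eq h₁
  obtain ⟨U₂, hU₂⟩ := P₂.exists_linearIsometry_range_eq h₂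
  rw [show (P₁ : Set (EuclideanSpace ℝ (Fin 4))) = range U₁ from Set.ext hU₁,
    show (P₂ : Set (EuclideanSpace ℝ (Fin 4))) = range U₂ from Set.ext hU₂]
  exact isAlmgrenMinimal_range_union_range (by norm_num) fun x y =>
    Submodule.isOrtho_iff_inner_eq.1 hP _ ((hU₁ _).2 ⟨x, rfl⟩) _ ((hU₂ _).2 ⟨y, rfl⟩)
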